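/- **Setting.** Let $\mathcal H_d$ be the real space of Hermitian $d\times d$ complex matrices and $\mathcal S_d$ the set of density operators (positive semi-definite, unit trace). The support of $A$ is the orthogonal complement of its kernel; $A\ll B$ means that the support of $A$ is contained in that of $B$. For positive semi-definite $A$ and real $s\neq0$, $A^s$ is defined by spectral calculus with $0^s:=0$ (so negative powers are generalized inverses). For $\rho,\sigma\in\mathcal S_d$ and $\alpha\in(0,1)\cup(1,\infty)$ the Petz–Rényi divergence is $$\mathsf D_\alpha(\rho\|\sigma)=\frac1{\alpha-1}\log\operatorname{Tr}[\rho^\alpha\sigma^{1-\alpha}]$$ if $\rho\ll\sigma$, or if $\alpha\in(0,1)$ and the supports of $\rho$ and $\sigma$ are not orthogonal; otherwise $\mathsf D_\alpha(\rho\|\sigma)=\infty$. For positive semi-definite $A$ with support projection $P_A$, $D[A^s]$ and $D^2[A^s]$ denote the first and second Fréchet derivatives at $K=0$ of the map $\mathcal H_d\ni K\mapsto (A+P_AKP_A)^s$ (for $A>0$ these are the usual Fréchet derivatives of the power function at $A$). Weak convergence $\xrightarrow{w}$ of random operators is with respect to the norm topology of $\mathbb C^{d\times d}$. **Theorem.**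 Let $\alpha\in(0,1)\cup(1,2]$ and $\bar\alpha=1-\alpha$. Let $\rho,\sigma\in\mathcal S_d$, let $\rho_n,\sigma_n$ ($n\in\mathbb N$) be random density operators, i.e. Borel-measurable maps from a probability space to $\mathcal S_d$, and suppose that $\rho_n\ll\sigma_n\ll\sigma$ and $\rho_n\ll\rho\ll\sigma$ almost surely for every $n$. Let $(r_n)$ be a sequence of positive reals with $r_n\to\infty$, and let $L_1,L_2$ be random elements of $\mathcal H_d$. Then $D[\rho^\alpha]$, $D^2[\rho^\alpha]$, $D[\sigma^{\bar\alpha}]$ and $D^2[\sigma^{\bar\alpha}]$ exist, and the following hold. (i) (Alternative) If $\big(r_n(\rho_n-\rho),r_n(\sigma_n-\sigma)\big)\xrightarrow{w}(L_1,L_2)$, then $$r_n\big(\mathsf D_\alpha(\rho_n\|\sigma_n)-\mathsf D_\alpha(\rho\|\sigma)\big)\xrightarrow{w}\frac{\operatorname{Tr}[\sigma^{\bar\alpha}D[\rho^\alpha](L_1)]+\operatorname{Tr}[\rho^\alpha D[\sigma^{\bar\alpha}](L_2)]}{(\alpha-1)\operatorname{Tr}[\rho^\alpha\sigma^{\bar\alpha}]}.$$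 (ii) (Null) If $\rho=\sigma$ and $\big(r_n(\rho_n-\rho),r_n(\sigma_n-\rho)\big)\xrightarrow{w}(L_1,L_2)$, then $$r_n^2\,\mathsf D_\alpha(\rho_n\|\sigma_n)\xrightarrow{w}\frac{\operatorname{Tr}\big[\rho^{\bar\alpha}D^2[\rho^\alpha](L_1,L_1)+\rho^\alpha D^2[\rho^{\bar\alpha}](L_2,L_2)+2\,D[\rho^\alpha](L_1)\,D[\rho^{\bar\alpha}](L_2)\big]}{2(\alpha-1)}.$$ -/

import Mathlib

open MeasureTheory ProbabilityTheory Filter Topology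
open scoped Matrix.Norms.L2Operator ComplexOrder

noncomputable section

namespace QDiv

/-- Linear operators on the `d`-dimensional complex Hilbert space, as `d × d` matrices. -/
abbrev Op (d : ℕ) : Type := Matrix (Fin d) (Fin d) ℂ

/-- The real normed space of Hermitian operators. -/
abbrev Herm (d : ℕ) : Type := selfAdjoint.submodule ℝ (Op d)

/-- Operators carry their Borel σ-algebra. -/
instance instMeasurableSpaceOp (d : ℕ) : MeasurableSpace (Matrix (Fin d) (Fin d) ℂ) := borel _

instance instBorelSpaceOp (d : ℕ) : BorelSpace (Matrix (Fin d) (Fin d) ℂ) := ⟨rfl⟩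

instance instSecondCountableOp (d : ℕ) :
    SecondCountableTopology (Matrix (Fin d) (Fin d) ℂ) :=
  inferInstanceAs (SecondCountableTopology (Fin d → Fin d → ℂ))

/-- Density operators: positive semi-definite with unit trace. -/
def IsDensity {d : ℕ} (ρ : Op d) : Prop := ρ.PosSemidef ∧ ρ.trace = 1

/-- The support of an operator: the orthogonal complement of its kernel. -/
def supp {d : ℕ} (A : Op d) : Submodule ℂ (EuclideanSpace ℂ (Fin d)) :=
  (LinearMap.ker (Matrix.toEuclideanLin A))ᗮ

/-- `A ≪ B` for operators: the support of `A` is contained in the support of `B`. -/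
def SuppLE {d : ℕ} (A B : Op d) : Prop := supp A ≤ supp B

/-- The orthogonal projection onto the support of `A`, as a matrix. -/
def suppProj {d : ℕ} (A : Op d) : Op d :=
  (Matrix.toEuclideanCLM (n := Fin d) (𝕜 := ℂ)).symm (supp A).starProjection

/-- The power `A ^ s` of a positive semi-definite operator by spectral calculus. As `0 ^ s = 0` for
real `s ≠ 0`, it vanishes off the support of `A`, also for `s < 0` (generalized inverse). -/
def opPow {d : ℕ} (s : ℝ) (A : Op d) : Op d := cfc (fun x : ℝ => x ^ s) A

/-- The Petz–Rényi divergence of order `α`, with values in `(-∞, ∞]`. The trace is a nonnegative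
real number, so its real part is the trace itself. -/
def petzRenyi {d : ℕ} (α : ℝ) (ρ σ : Op d) : EReal :=
  open Classical in
  if SuppLE ρ σ ∨ (α < 1 ∧ ¬ (supp ρ ⟂ supp σ)) then
    ((1 / (α - 1) * Real.log (opPow α ρ * opPow (1 - α) σ).trace.re : ℝ) : EReal)
  else ⊤

/-- The map `K ↦ (A + P K P) ^ s` on Hermitian operators, `P` being the projection onto the support
of `A`. If `A` is invertible then `P = 1` and this is `K ↦ (A + K) ^ s`; in general it is the power
function near `A` on the operators of the support of `A`. -/
def powNear {d : ℕ} (s : ℝ) (A : Op d) (K : Herm d) : Op d :=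
  opPow s (A + suppProj A * (K : Op d) * suppProj A)

/-- The first Fréchet derivative `D[A ^ s](H)` of the power function at `A`, relative to the support
of `A`. -/
def DPow {d : ℕ} (s : ℝ) (A : Op d) (H : Herm d) : Op d :=
  fderiv ℝ (powNear s A) 0 H

/-- The second Fréchet derivative `D²[A ^ s](H₁, H₂)` of the power function at `A`, relative to the
support of `A`. -/
def D2Pow {d : ℕ} (s : ℝ) (A : Op d) (H₁ H₂ : Herm d) : Op d :=
  fderiv ℝ (fderiv ℝ (powNear s A)) 0 H₁ H₂

/-- The power function is twice Fréchet differentiable at `A` (relative to the support of `A`). -/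
def TwiceDiffPow {d : ℕ} (s : ℝ) (A : Op d) : Prop :=
  (∀ᶠ K in 𝓝 (0 : Herm d), DifferentiableAt ℝ (powNear s A) K) ∧
    DifferentiableAt ℝ (fderiv ℝ (powNear s A)) 0

end QDiv

end

/-!
The divergence depends on the data only through the overlap `Tr[ρ ^ α σ ^ (1 - α)]`, and everything
rests on expanding the overlap to second order and feeding the expansion into a delta method.

*Smoothness of powers.* Since `ρₙ ≪ ρ` and `σₙ ≪ σ`, the powers of `ρₙ` and `σₙ` are exactly the
values of the maps `powNear` at `ρₙ - ρ` and `σₙ - σ` (`powNear_sub`). With `P` the support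
projection of `A`, the operator `B = A + (1 - P)` is positive definite and
`(A + P K P) ^ s = (B + P K P) ^ s - (1 - P)` (`powNear_eq_sub`). Near a positive definite operator
the power is `c ^ s` times the binomial series at `c⁻¹ X - 1`, an operator of norm less than one, so
it is analytic and `powNear` is `C²` at `0` (`contDiffAt_powNear`).

*Alternative.* The overlap at `(ρ, σ)` is positive (`trace_re_opPow_mul_opPow_pos`), so its
logarithm is differentiable, and the delta method gives the limit.

*Null.* If `ρ = σ`, the first-order term has to vanish on differences of density operators. This
follows from `Tr[A ^ (1 - s) D[A ^ s](K)] = s Tr[P K P]` (`traceRe_opPow_mul_DPow`), which is a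
first-order condition: by Young's inequality `x ^ s y ^ (1 - s) ≤ s x + (1 - s) y` for `0 < s < 1`,
and the reverse inequality for the other `s`, transferred to traces by a Klein-type inequality
(`trace_cfc_mul_cfc_nonneg`), the function `K ↦ Tr[A ^ (1 - s) (A + P K P) ^ s] - s Tr[P K P]` has a
local extremum at `0`. As the overlap is `1` at the base point, the logarithm then contributes only
half of the second derivative of the overlap.

*Delta method.* If `Xₙ ⇒ L` and `Fₙ → f` uniformly on balls with `f` continuous, then
`Fₙ(Xₙ) ⇒ f(L)`, because `(Xₙ)` is tight (`tendstoInDistribution_of_tendstoUniformlyOn`). It is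
applied to the rescalings `Fₙ(x) = rₙ ^ k G(rₙ⁻¹ x)` of a function `G` whose expansion at `0` starts
with a term homogeneous of degree `k`, for `k = 1` and `k = 2`.
-/

namespace QDiv

open Asymptotics

variable {d : ℕ}

/-! ### Second-order Taylor expansion and the delta method -/

/-- Taylor's theorem of order two with Peano remainder: twice differentiability at the base point
suffices, by the mean value inequality for the remainder on a small ball. -/
theorem isLittleO_sub_taylor_two {E F : Type*} [NormedAddCommGroup E] [NormedSpace ℝ E]
    [NormedAddCommGroup F] [NormedSpace ℝ F] {f : E → F}
    (hf : ∀ᶠ x in 𝓝 (0 : E), DifferentiableAt ℝ f x)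
    (hf' : DifferentiableAt ℝ (fderiv ℝ f) 0) :
    (fun h => f h - f 0 - fderiv ℝ f 0 h - (1 / 2 : ℝ) • fderiv ℝ (fderiv ℝ f) 0 h h)
      =o[𝓝 0] fun h => ‖h‖ ^ 2 := by
  set D := fderiv ℝ f 0
  set B := fderiv ℝ (fderiv ℝ f) 0
  have hsymm : ∀ v w, B v w = B w v := fun v w =>
    second_derivative_symmetric_of_eventually (hf.mono fun x hx => hx.hasFDerivAt)
      hf'.hasFDerivAt v w
  have hB : (fun y => fderiv ℝ f y - D - B y) =o[𝓝 0] fun y => y := by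
    simpa using hf'.hasFDerivAt.isLittleO
  rw [isLittleO_iff] at hB ⊢
  intro c hc
  obtain ⟨δ, hδ, hball⟩ := Metric.eventually_nhds_iff_ball.1 ((hB hc).and hf)
  filter_upwards [Metric.ball_mem_nhds (0 : E) hδ] with h hh
  let g : E → F := fun h => f h - f 0 - D h - (1 / 2 : ℝ) • B h h
  have hg : ∀ x ∈ Metric.closedBall (0 : E) ‖h‖,
      HasFDerivWithinAt g (fderiv ℝ f x - D - B x) (Metric.closedBall (0 : E) ‖h‖) x := by
    intro x hx
    have hx' : x ∈ Metric.ball (0 : E) δ := by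
      rw [mem_closedBall_zero_iff] at hx
      rw [mem_ball_zero_iff] at hh ⊢
      exact hx.trans_lt hh
    have h1 : HasFDerivAt (fun x => B x x) (2 • B x) x := by
      have := (B.hasFDerivAt (x := x)).clm_apply (hasFDerivAt_id x)
      refine HasFDerivAt.congr_fderiv this ?_
      ext w
      simp [two_smul, hsymm w x]
    have h2 := ((((hball x hx').2.hasFDerivAt.sub_const (f 0)).sub D.hasFDerivAt).sub
      (h1.const_smul (1 / 2 : ℝ)))
    refine HasFDerivAt.hasFDerivWithinAt (h2.congr_fderiv ?_)
    ext w
    simp [two_smul, ← add_smul, ← two_mul]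
  have hbound : ∀ x ∈ Metric.closedBall (0 : E) ‖h‖, ‖fderiv ℝ f x - D - B x‖ ≤ c * ‖h‖ := by
    intro x hx
    rw [mem_closedBall_zero_iff] at hx
    have hx' : x ∈ Metric.ball (0 : E) δ := by
      rw [mem_ball_zero_iff] at hh ⊢
      exact hx.trans_lt hh
    exact (hball x hx').1.trans (by gcongr)
  have := (convex_closedBall (0 : E) ‖h‖).norm_image_sub_le_of_norm_hasFDerivWithin_le hg hbound
    (x := 0) (y := h) (by simp) (by simp)
  simpa [g, pow_two, mul_assoc] using this

theorem isBigO_fderiv_fderiv {E F : Type*} [NormedAddCommGroup E] [NormedSpace ℝ E]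
    [NormedAddCommGroup F] [NormedSpace ℝ F] (f : E → F) (l : Filter E) :
    (fun h => fderiv ℝ (fderiv ℝ f) 0 h h) =O[l] fun h => ‖h‖ ^ 2 :=
  IsBigO.of_bound ‖fderiv ℝ (fderiv ℝ f) 0‖ (Eventually.of_forall fun h => by
    simpa [pow_two, mul_assoc] using (fderiv ℝ (fderiv ℝ f) 0).le_opNorm₂ h h)

section DeltaMethod

variable {Ω Ω' : Type*} [MeasurableSpace Ω] [MeasurableSpace Ω']
    {P : Measure Ω} [IsProbabilityMeasure P] {P' : Measure Ω'} [IsProbabilityMeasure P']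
    {E : Type*} [NormedAddCommGroup E] [MeasurableSpace E] [BorelSpace E]

/-- Tightness of a sequence that converges in distribution, from the portmanteau theorem for the
closed sets `{x | M ≤ ‖x‖}`. -/
theorem exists_eventually_measure_le_norm_le {X : ℕ → Ω → E} {Z : Ω' → E}
    (h : TendstoInDistribution X atTop Z (fun _ => P) P') {ε : ENNReal} (hε : 0 < ε) :
    ∃ M : ℕ, ∀ᶠ n in atTop, P {ω | (M : ℝ) ≤ ‖X n ω‖} ≤ ε := by
  let F : ℕ → Set E := fun M => {x | (M : ℝ) ≤ ‖x‖}
  have hF : ∀ M, IsClosed (F M) := fun M => isClosed_le continuous_const continuous_norm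
  have hlim : Tendsto (fun M => P'.map Z (F M)) atTop (𝓝 0) := by
    have : IsProbabilityMeasure (P'.map Z) := Measure.isProbabilityMeasure_map h.aemeasurable_limit
    have h1 := tendsto_measure_iInter_atTop (μ := P'.map Z) (s := F)
      (fun M => (hF M).measurableSet.nullMeasurableSet)
      (fun a b hab x (hx : (b : ℝ) ≤ ‖x‖) => (Nat.cast_le.2 hab).trans hx) ⟨0, measure_ne_top _ _⟩
    have h2 : ⋂ M, F M = ∅ := by
      refine Set.eq_empty_of_forall_notMem fun x hx => ?_
      obtain ⟨M, hM⟩ := exists_nat_gt ‖x‖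
      exact absurd (Set.mem_iInter.1 hx M) (not_le.2 hM)
    simpa [h2, Function.comp_def] using h1
  obtain ⟨M, hM⟩ := (hlim.eventually_lt_const hε).exists
  refine ⟨M, ?_⟩
  have hle := ProbabilityMeasure.limsup_measure_closed_le_of_tendsto h.tendsto (hF M)
  filter_upwards [eventually_lt_of_limsup_lt (hle.trans_lt hM)] with n hn
  have := hn.le
  simp only [ProbabilityMeasure.coe_mk] at this
  rwa [Measure.map_apply_of_aemeasurable (h.forall_aemeasurable n) (hF M).measurableSet] at this

/-- Extended continuous mapping theorem: the maps `F n` may vary as long as they converge uniformly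
on balls. No measurability of `F n` is needed. -/
theorem tendstoInDistribution_of_tendstoUniformlyOn {X : ℕ → Ω → E} {Z : Ω' → E}
    (h : TendstoInDistribution X atTop Z (fun _ => P) P') {Y : ℕ → Ω → ℝ}
    (hY : ∀ n, AEMeasurable (Y n) P) {F : ℕ → E → ℝ} {f : E → ℝ} (hf : Continuous f)
    (hF : ∀ M : ℝ, TendstoUniformlyOn F f atTop (Metric.closedBall 0 M))
    (hYF : ∀ n, ∀ᵐ ω ∂P, Y n ω = F n (X n ω)) :
    TendstoInDistribution Y atTop (fun ω => f (Z ω)) (fun _ => P) P' := by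
  refine tendstoInDistribution_of_tendstoInMeasure_sub (X := fun n => f ∘ X n) Y _
    (h.continuous_comp hf) ?_ hY
  intro ε hε
  rw [ENNReal.tendsto_nhds_zero]
  intro η hη
  obtain ⟨M, hM⟩ := exists_eventually_measure_le_norm_le h hη
  have hU := EMetric.tendstoUniformlyOn_iff.1 (hF M) ε hε
  filter_upwards [hM, hU] with n hn hn'
  refine le_trans (measure_mono_ae ?_) hn
  filter_upwards [hYF n] with ω hω hle
  by_contra hlt
  have hmem : X n ω ∈ Metric.closedBall (0 : E) M := by
    rw [mem_closedBall_zero_iff]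
    exact (not_le.1 hlt).le
  have h1 := hn' _ hmem
  have h2 : ε ≤ edist (Y n ω - f (X n ω)) 0 := hle
  rw [hω, edist_eq_enorm_sub, sub_zero, ← edist_eq_enorm_sub, edist_comm] at h2
  exact absurd h1 (not_lt.2 h2)

end DeltaMethod

/-! ### The binomial series in a C⋆-algebra -/

section
variable {𝔸 : Type*} [NormedRing 𝔸] [NormedAlgebra ℝ 𝔸]

/-- Mathlib has this bound for division rings; in a general Banach algebra it follows by comparison
with the real binomial series. -/
theorem one_le_radius_binomialSeries (s : ℝ) : 1 ≤ (binomialSeries 𝔸 s).radius := by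
  refine ENNReal.le_of_forall_nnreal_lt fun r hr => ?_
  refine FormalMultilinearSeries.le_radius_of_isBigO _ ?_
  have h : (r : ENNReal) < (binomialSeries ℝ s).radius :=
    hr.trans_le Real.one_add_rpow_hasFPowerSeriesOnBall_zero.r_le
  have h1 : (fun n => ‖binomialSeries ℝ s n‖ * (r : ℝ) ^ n) =O[atTop] fun _ => (1 : ℝ) :=
    (((binomialSeries ℝ s).summable_norm_mul_pow h).tendsto_atTop_zero).isBigO_one ℝ
  refine Asymptotics.IsBigO.trans (Asymptotics.IsBigO.of_bound 1 ?_) h1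
  filter_upwards [eventually_gt_atTop 0] with n hn
  have h2 : ‖binomialSeries 𝔸 s n‖ ≤ ‖binomialSeries ℝ s n‖ := by
    rw [binomialSeries, binomialSeries, FormalMultilinearSeries.ofScalars_norm ℝ]
    exact FormalMultilinearSeries.ofScalars_norm_le 𝔸 _ n hn
  rw [one_mul, norm_mul, norm_mul, norm_norm, norm_norm]
  gcongr

theorem hasFPowerSeriesOnBall_binomialSeries_sum [CompleteSpace 𝔸] (s : ℝ) :
    HasFPowerSeriesOnBall (binomialSeries 𝔸 s).sum (binomialSeries 𝔸 s) 0 1 :=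
  ((binomialSeries 𝔸 s).hasFPowerSeriesOnBall
    (zero_lt_one.trans_le (one_le_radius_binomialSeries s))).mono zero_lt_one
    (one_le_radius_binomialSeries s)

end

/-- The binomial series at a self-adjoint `y` with `‖y‖ < 1` is the functional calculus of
`(1 + x) ^ s`: the partial sums are polynomials converging uniformly on the spectrum. -/
theorem binomialSeries_sum_eq_cfc {𝔸 : Type*} [CStarAlgebra 𝔸] (s : ℝ) {y : 𝔸}
    (hy : IsSelfAdjoint y) (hy1 : ‖y‖ < 1) :
    (binomialSeries 𝔸 s).sum y = cfc (fun x : ℝ => (1 + x) ^ s) y := by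
  nontriviality 𝔸
  have hspec : spectrum ℝ y ⊆ Metric.closedBall 0 ‖y‖ := fun x hx => by
    simpa using spectrum.norm_le_norm_of_mem hx
  obtain ⟨r, hr, hr1⟩ := exists_between hy1
  lift r to NNReal using (norm_nonneg y).trans hr.le
  have hr1' : (r : ENNReal) < 1 := by exact_mod_cast hr1
  have hsub : spectrum ℝ y ⊆ Metric.ball 0 r :=
    hspec.trans (Metric.closedBall_subset_ball hr)
  have hU : TendstoUniformlyOn (fun n x => (binomialSeries ℝ s).partialSum n x)
      (fun x : ℝ => (1 + x) ^ s) atTop (spectrum ℝ y) := by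
    have := (Real.one_add_rpow_hasFPowerSeriesOnBall_zero (a := s)).tendstoUniformlyOn hr1'
    simpa using this.mono hsub
  have hlim := tendsto_cfc_fun (a := y) hU (Eventually.of_forall fun n =>
    ((binomialSeries ℝ s).partialSum_continuous n).continuousOn)
  have hsum : Tendsto (fun n => (binomialSeries 𝔸 s).partialSum n y) atTop
      (𝓝 ((binomialSeries 𝔸 s).sum y)) := by
    have := (hasFPowerSeriesOnBall_binomialSeries_sum (𝔸 := 𝔸) s).tendsto_partialSum
      (y := y) (by
        rw [Metric.mem_eball, edist_zero_right, ← ofReal_norm]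
        exact ENNReal.ofReal_lt_one.2 hy1)
    simpa using this
  refine tendsto_nhds_unique hsum (hlim.congr fun n => ?_)
  simp only [FormalMultilinearSeries.partialSum, binomialSeries_apply,
    List.ofFn_const, List.prod_replicate]
  have hfun : (fun x : ℝ => ∑ i ∈ Finset.range n, Ring.choose s i • x ^ i)
      = ∑ i ∈ Finset.range n, fun x : ℝ => Ring.choose s i • x ^ i := by
    ext x; simp
  rw [hfun, cfc_sum _ _ _ (fun i _ => by fun_prop)]
  refine Finset.sum_congr rfl fun i _ => ?_
  rw [cfc_smul _ _ _ (by fun_prop), cfc_pow _ _ _ (by fun_prop), cfc_id' ℝ y]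

/-! ### Powers of Hermitian matrices -/

theorem continuousOn_spectrum_op (f : ℝ → ℝ) (A : Op d) : ContinuousOn f (spectrum ℝ A) :=
  Matrix.finite_real_spectrum.continuousOn f

theorem spectrum_nonneg_of_posSemidef {A : Op d} (hA : A.PosSemidef) {x : ℝ}
    (hx : x ∈ spectrum ℝ A) : 0 ≤ x := by
  rw [hA.1.spectrum_real_eq_range_eigenvalues] at hx
  obtain ⟨i, rfl⟩ := hx
  exact hA.eigenvalues_nonneg i

theorem posDef_iff_spectrum_pos {A : Op d} (hA : A.IsHermitian) :
    A.PosDef ↔ ∀ x ∈ spectrum ℝ A, 0 < x := by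
  rw [hA.posDef_iff_eigenvalues_pos, hA.spectrum_real_eq_range_eigenvalues, Set.forall_mem_range]

theorem opPow_isSelfAdjoint (s : ℝ) (A : Op d) : IsSelfAdjoint (opPow s A) := cfc_predicate _ _

theorem opPow_one {A : Op d} (hA : IsSelfAdjoint A) : opPow 1 A = A := by
  simp only [opPow, Real.rpow_one]
  exact cfc_id' ℝ A

theorem opPow_mul_opPow {A : Op d} (hA : A.PosSemidef) {s t : ℝ} (hst : s + t ≠ 0) :
    opPow s A * opPow t A = opPow (s + t) A := by
  have hA' : IsSelfAdjoint A := hA.1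
  rw [opPow, opPow, opPow, ← cfc_mul _ _ _ (continuousOn_spectrum_op _ _)
    (continuousOn_spectrum_op _ _)]
  refine cfc_congr fun x hx => ?_
  rcases (spectrum_nonneg_of_posSemidef hA hx).eq_or_lt with rfl | hx
  · by_cases hs : s = 0
    · subst hs
      simp [Real.zero_rpow (by simpa using hst : t ≠ 0)]
    · simp [Real.zero_rpow hst, Real.zero_rpow hs]
  · exact (Real.rpow_add hx s t).symm

theorem mul_opPow_eq_zero {A C : Op d} (hA : IsSelfAdjoint A) {s : ℝ} (hs : s ≠ 0)
    (h : C * A = 0) : C * opPow s A = 0 := by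
  have h1 : opPow s A = A * cfc (fun x : ℝ => x ^ s * x⁻¹) A := by
    nth_rw 2 [← cfc_id' ℝ A]
    rw [opPow, ← cfc_mul _ _ _ (continuousOn_spectrum_op _ _) (continuousOn_spectrum_op _ _)]
    refine cfc_congr fun x _ => ?_
    by_cases hx : x = 0
    · simp [hx, Real.zero_rpow hs]
    · change x ^ s = x * (x ^ s * x⁻¹)
      field_simp
  rw [h1, ← mul_assoc, h, zero_mul]

theorem aeval_add_of_mul_eq_zero {R 𝔸 : Type*} [CommRing R] [Ring 𝔸] [Algebra R 𝔸] {X Q : 𝔸}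
    (hQ : Q * Q = Q) (hXQ : X * Q = 0) (hQX : Q * X = 0) (p : Polynomial R) :
    Polynomial.aeval (X + Q) p = Polynomial.aeval X p + (p.eval 1 - p.eval 0) • Q := by
  have hpow : ∀ n : ℕ, (X + Q) ^ (n + 1) = X ^ (n + 1) + Q := by
    intro n
    induction n with
    | zero => simp
    | succ n ih =>
      rw [pow_succ, ih, mul_add, add_mul, add_mul, hQX, hQ, pow_succ X n, mul_assoc, mul_assoc,
        hXQ, mul_zero, pow_succ X (n + 1), pow_succ X n]
      simp [mul_assoc]
  induction p using Polynomial.induction_on' with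
  | add p q hp hq => simp only [map_add, hp, hq, Polynomial.eval_add]; module
  | monomial n c =>
    cases n with
    | zero => simp
    | succ n => simp [Polynomial.aeval_monomial, hpow, mul_add, Algebra.smul_def]

/-- Adding an orthogonal projection to `X` adds it to `f(X)` if `f` fixes `0` and `1`. On the finite
spectra involved `f` is a polynomial, so the identity reduces to one for powers. -/
theorem cfc_add_of_mul_eq_zero {X Q : Op d} (hX : IsSelfAdjoint X) (hQs : IsSelfAdjoint Q)
    (hQ : Q * Q = Q) (hXQ : X * Q = 0) (hQX : Q * X = 0) {f : ℝ → ℝ} (hf0 : f 0 = 0)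
    (hf1 : f 1 = 1) : cfc f (X + Q) = cfc f X + Q := by
  classical
  have hfin : (spectrum ℝ X ∪ spectrum ℝ (X + Q) ∪ {0, 1}).Finite :=
    (Matrix.finite_real_spectrum.union Matrix.finite_real_spectrum).union (by simp)
  obtain ⟨p, hp⟩ : ∃ p : Polynomial ℝ, ∀ x ∈ spectrum ℝ X ∪ spectrum ℝ (X + Q) ∪ {0, 1},
      p.eval x = f x :=
    ⟨Lagrange.interpolate hfin.toFinset id f, fun x hx =>
      Lagrange.eval_interpolate_at_node (v := id) f (Set.injOn_id _) (hfin.mem_toFinset.2 hx)⟩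
  have h1 : cfc f (X + Q) = cfc (fun x => p.eval x) (X + Q) :=
    cfc_congr fun x hx => (hp x (by simp [hx])).symm
  have h2 : cfc f X = cfc (fun x => p.eval x) X :=
    cfc_congr fun x hx => (hp x (by simp [hx])).symm
  rw [h1, h2, cfc_polynomial p X hX, cfc_polynomial p (X + Q) (hX.add hQs),
    aeval_add_of_mul_eq_zero hQ hXQ hQX, hp 0 (by simp), hp 1 (by simp), hf0, hf1]
  simp

theorem smul_sub_one_eq_cfc {X : Op d} (hX : IsSelfAdjoint X) (c : ℝ) :
    c • X - 1 = cfc (fun x : ℝ => c * x - 1) X := by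
  rw [cfc_sub _ _ _ (continuousOn_spectrum_op _ _) (continuousOn_spectrum_op _ _),
    cfc_const_mul_id _ _, cfc_const_one ℝ X]

theorem spectrum_pos_of_norm_lt_one {X : Op d} (hX : IsSelfAdjoint X) {c : ℝ} (hc : 0 < c)
    (h : ‖c⁻¹ • X - 1‖ < 1) {x : ℝ} (hx : x ∈ spectrum ℝ X) : 0 < x := by
  rw [smul_sub_one_eq_cfc hX] at h
  have h1 := (norm_apply_le_norm_cfc (fun x : ℝ => c⁻¹ * x - 1) X hx
    (continuousOn_spectrum_op _ _)).trans_lt h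
  have h2 := (abs_lt.1 h1).1
  have h3 : 0 < c⁻¹ * x := by linarith
  exact pos_of_mul_pos_right h3 (inv_pos.2 hc).le

/-- The power `X ^ s` written as a binomial series around `c • 1`. It equals `opPow s X` for
self-adjoint `X` with `‖c⁻¹ • X - 1‖ < 1`, and it is analytic on that ball of the
whole algebra, without self-adjointness. -/
noncomputable def binomialPow (s c : ℝ) (X : Op d) : Op d :=
  c ^ s • (binomialSeries (Op d) s).sum (c⁻¹ • X - 1)

theorem opPow_eq_binomialPow (s : ℝ) {X : Op d} (hX : IsSelfAdjoint X) {c : ℝ} (hc : 0 < c)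
    (h : ‖c⁻¹ • X - 1‖ < 1) : opPow s X = binomialPow s c X := by
  have hsa : IsSelfAdjoint (c⁻¹ • X - 1) := ((IsSelfAdjoint.all c⁻¹).smul hX).sub (.one _)
  rw [binomialPow, binomialSeries_sum_eq_cfc s hsa h, smul_sub_one_eq_cfc hX,
    ← cfc_comp' _ _ _ ((Matrix.finite_real_spectrum.image _).continuousOn _)
      (continuousOn_spectrum_op _ _), ← cfc_smul _ _ _ (continuousOn_spectrum_op _ _), opPow]
  refine cfc_congr fun x hx => ?_
  have hx := spectrum_pos_of_norm_lt_one hX hc h hx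
  simp only [smul_eq_mul, add_sub_cancel]
  rw [← Real.mul_rpow hc.le (by positivity), mul_inv_cancel_left₀ hc.ne']

theorem contDiffAt_binomialPow (s : ℝ) {X : Op d} {c : ℝ} (h : ‖c⁻¹ • X - 1‖ < 1) :
    ContDiffAt ℝ 2 (binomialPow (d := d) s c) X := by
  have h1 : AnalyticAt ℝ (binomialSeries (Op d) s).sum (c⁻¹ • X - 1) := by
    refine (hasFPowerSeriesOnBall_binomialSeries_sum s).analyticAt_of_mem ?_
    rw [Metric.mem_eball, edist_zero_right, ← ofReal_norm]
    exact ENNReal.ofReal_lt_one.2 h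
  have h2 : ContDiffAt ℝ 2 (fun X : Op d => c⁻¹ • X - 1) X := by fun_prop
  exact (ContDiffAt.comp X h1.contDiffAt h2).const_smul (c ^ s)

/-- Every positive definite operator lies in the domain of some binomial expansion. -/
theorem exists_norm_smul_sub_one_lt {B : Op d} (hB : B.PosDef) :
    ∃ c : ℝ, 0 < c ∧ ‖c⁻¹ • B - 1‖ < 1 := by
  have hsa : IsSelfAdjoint B := hB.1
  refine ⟨‖B‖ + 1, by positivity, ?_⟩
  rw [smul_sub_one_eq_cfc hsa]
  refine norm_cfc_lt zero_lt_one fun x hx => ?_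
  have h0 := (posDef_iff_spectrum_pos hB.1).1 hB x hx
  have h1 : x ≤ ‖B‖ := by
    rcases isEmpty_or_nonempty (Fin d) with hd | hd
    · exact absurd hx (by simp [spectrum.of_subsingleton])
    · exact (le_abs_self x).trans (spectrum.norm_le_norm_of_mem hx)
  have hpos : 0 < ‖B‖ + 1 := by positivity
  have h2 : 0 < (‖B‖ + 1)⁻¹ * x := by positivity
  have h3 : (‖B‖ + 1)⁻¹ * x ≤ 1 := by
    rw [inv_mul_le_iff₀ hpos]; linarith
  rw [Real.norm_eq_abs, abs_lt]
  constructor <;> linarith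

/-! ### Support projections -/

theorem suppProj_isSelfAdjoint (A : Op d) : IsSelfAdjoint (suppProj A) := by
  rw [IsSelfAdjoint, suppProj]
  refine ((Matrix.toEuclideanCLM (n := Fin d) (𝕜 := ℂ)).symm.map_star' _).symm.trans ?_
  rw [(isSelfAdjoint_starProjection (supp A)).star_eq]
  rfl

theorem suppProj_mul_self (A : Op d) : suppProj A * suppProj A = suppProj A := by
  rw [suppProj, ← map_mul, (supp A).isIdempotentElem_starProjection.eq]

theorem toEuclideanCLM_suppProj_mul (A C : Op d) (x : EuclideanSpace ℂ (Fin d)) :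
    Matrix.toEuclideanCLM (n := Fin d) (𝕜 := ℂ) (suppProj A * C) x
      = (supp A).starProjection (Matrix.toEuclideanCLM (n := Fin d) (𝕜 := ℂ) C x) := by
  simp [suppProj]

theorem toEuclideanCLM_ext {B C : Op d} (h : ∀ x, Matrix.toEuclideanCLM (n := Fin d) (𝕜 := ℂ) B x
    = Matrix.toEuclideanCLM (n := Fin d) (𝕜 := ℂ) C x) : B = C :=
  (Matrix.toEuclideanCLM (n := Fin d) (𝕜 := ℂ)).injective (ContinuousLinearMap.ext h)

theorem suppProj_mul_of_suppLE {A B : Op d} (hB : B.IsHermitian) (h : SuppLE B A) :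
    suppProj A * B = B := by
  refine toEuclideanCLM_ext fun x => ?_
  rw [toEuclideanCLM_suppProj_mul, Submodule.starProjection_eq_self_iff]
  refine h ((Submodule.mem_orthogonal _ _).2 fun y hy => ?_)
  have hsa : IsSelfAdjoint (Matrix.toEuclideanCLM (n := Fin d) (𝕜 := ℂ) B) := by
    rw [IsSelfAdjoint, ← map_star]
    exact congrArg _ hB
  have hy : Matrix.toEuclideanCLM (n := Fin d) (𝕜 := ℂ) B y = 0 := hy
  rw [← ContinuousLinearMap.adjoint_inner_left, ← ContinuousLinearMap.star_eq_adjoint,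
    hsa.star_eq, hy, inner_zero_left]

theorem suppProj_mul {A : Op d} (hA : A.IsHermitian) : suppProj A * A = A :=
  suppProj_mul_of_suppLE hA le_rfl

theorem mul_suppProj_of_suppLE {A B : Op d} (hB : B.IsHermitian) (h : SuppLE B A) :
    B * suppProj A = B := by
  have h1 := congrArg star (suppProj_mul_of_suppLE hB h)
  rwa [star_mul, (suppProj_isSelfAdjoint A).star_eq, show star B = B from hB] at h1

theorem mul_suppProj {A : Op d} (hA : A.IsHermitian) : A * suppProj A = A :=
  mul_suppProj_of_suppLE hA le_rfl

theorem suppProj_mul_eq_zero {A C : Op d} (h : A * C = 0) : suppProj A * C = 0 := by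
  refine toEuclideanCLM_ext fun x => ?_
  rw [toEuclideanCLM_suppProj_mul, map_zero, zero_apply,
    Submodule.starProjection_apply_eq_zero_iff]
  refine Submodule.le_orthogonal_orthogonal _ ?_
  change Matrix.toEuclideanCLM (n := Fin d) (𝕜 := ℂ) A _ = 0
  rw [← mul_apply_eq_comp, ← map_mul, h, map_zero, zero_apply]

theorem posDef_add_one_sub_suppProj {A : Op d} (hA : A.PosSemidef) :
    (A + (1 - suppProj A)).PosDef := by
  set Q : Op d := 1 - suppProj A
  have hQs : IsSelfAdjoint Q := (IsSelfAdjoint.one _).sub (suppProj_isSelfAdjoint A)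
  have hQQ : Q * Q = Q := by
    simp [Q, mul_sub, sub_mul, suppProj_mul_self]
  have hQ : Q.PosSemidef := by
    have := Matrix.posSemidef_conjTranspose_mul_self Q
    rwa [show Q.conjTranspose = Q from hQs, hQQ] at this
  refine (hA.add hQ).posDef_iff_isUnit.2 ?_
  refine IsArtinianRing.isUnit_iff_isRightRegular.2
    (isRightRegular_iff_left_eq_zero_of_mul.2 fun C hC => ?_)
  -- Multiplying `C (A + Q) = 0` by the projection gives `C A = 0`, and then `C Q = 0`.
  have hPQ : (A + Q) * suppProj A = A := by
    simp [Q, add_mul, sub_mul, suppProj_mul_self, mul_suppProj hA.1]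
  have h1 : C * A = 0 := by rw [← hPQ, ← mul_assoc, hC, zero_mul]
  have h2 : C * Q = 0 := by rwa [mul_add, h1, zero_add] at hC
  have h3 : A * star C = 0 := by
    rw [← show star A = A from hA.1, ← star_mul, h1, star_zero]
  have h4 := suppProj_mul_eq_zero h3
  have h5 : Q * star C = 0 := by rw [← hQs.star_eq, ← star_mul, h2, star_zero]
  rw [← star_eq_zero]
  simpa [Q, sub_mul, h4] using h5

/-! ### Differentiability of powers on the support and a Klein-type trace inequality -/

/-- The compression `K ↦ P K P` to the support of `A`, `P` being the support projection. -/
noncomputable def compression (A : Op d) : Herm d →L[ℝ] Op d :=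
  (ContinuousLinearMap.mul ℝ (Op d) (suppProj A)).comp
    (((ContinuousLinearMap.mul ℝ (Op d)).flip (suppProj A)).comp
      (LinearMap.toContinuousLinearMap (selfAdjoint.submodule ℝ (Op d)).subtype))

theorem compression_apply (A : Op d) (K : Herm d) :
    compression A K = suppProj A * (K : Op d) * suppProj A := by
  simp [compression, mul_assoc]

theorem compression_isSelfAdjoint (A : Op d) (K : Herm d) : IsSelfAdjoint (compression A K) := by
  have h := suppProj_isSelfAdjoint A
  rw [compression_apply]
  nth_rw 2 [← h.star_eq]
  exact IsSelfAdjoint.conjugate K.2 _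

/-- Adding the projection `1 - P` onto the kernel moves `powNear` to a positive
definite base point. -/
theorem powNear_eq_sub {s : ℝ} (hs : s ≠ 0) {A : Op d} (hA : A.PosSemidef) (K : Herm d) :
    powNear s A K
      = opPow s (A + (1 - suppProj A) + compression A K) - (1 - suppProj A) := by
  have hP := suppProj_mul_self A
  rw [powNear, eq_sub_iff_add_eq, ← compression_apply, add_right_comm, opPow, opPow,
    cfc_add_of_mul_eq_zero (f := fun x => x ^ s)
      (IsSelfAdjoint.add hA.1 (compression_isSelfAdjoint A K))
      ((IsSelfAdjoint.one _).sub (suppProj_isSelfAdjoint A))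
      (by simp [mul_sub, sub_mul, hP]) _ _ (Real.zero_rpow hs) (Real.one_rpow s)]
  · rw [compression_apply]
    simp only [add_mul, mul_sub, mul_one, mul_suppProj hA.1, mul_assoc, hP, sub_self]
  · rw [compression_apply]
    simp only [mul_add, sub_mul, one_mul, suppProj_mul hA.1, ← mul_assoc, hP, sub_self, zero_mul,
      add_zero]

theorem contDiffAt_powNear {s : ℝ} (hs : s ≠ 0) {A : Op d} (hA : A.PosSemidef) :
    ContDiffAt ℝ 2 (powNear s A) 0 := by
  set B : Op d := A + (1 - suppProj A) with hBdef
  have hB : B.PosDef := posDef_add_one_sub_suppProj hA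
  obtain ⟨c, hc, hcB⟩ := exists_norm_smul_sub_one_lt hB
  have hcont : Continuous fun K : Herm d => ‖c⁻¹ • (B + compression A K) - 1‖ := by fun_prop
  have hev : ∀ᶠ K : Herm d in 𝓝 0, ‖c⁻¹ • (B + compression A K) - 1‖ < 1 := by
    refine hcont.continuousAt.eventually_lt_const ?_
    simpa using hcB
  have heq : powNear s A =ᶠ[𝓝 0]
      fun K => binomialPow s c (B + compression A K) - (1 - suppProj A) := by
    filter_upwards [hev] with K hK
    rw [powNear_eq_sub hs hA, opPow_eq_binomialPow s
      (IsSelfAdjoint.add hB.1 (compression_isSelfAdjoint A K)) hc hK]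
  refine ContDiffAt.congr_of_eventuallyEq (ContDiffAt.sub ?_ contDiffAt_const) heq
  refine ContDiffAt.comp (g := binomialPow s c) 0 (contDiffAt_binomialPow s ?_) (by fun_prop)
  simpa using hcB

theorem twiceDiffPow {s : ℝ} (hs : s ≠ 0) {A : Op d} (hA : A.PosSemidef) : TwiceDiffPow s A := by
  have h := contDiffAt_powNear hs hA
  refine ⟨(h.eventually (by simp)).mono fun K hK => hK.differentiableAt (by simp), ?_⟩
  exact (h.fderiv_right (m := 1) (by norm_num)).differentiableAt (by simp)

/-- On an operator dominated by `A` the compression in `powNear` does nothing. -/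
theorem powNear_sub {s : ℝ} {A B : Op d} (hA : A.IsHermitian) (hB : B.IsHermitian)
    (hBA : SuppLE B A) {K : Herm d} (hK : (K : Op d) = B - A) : powNear s A K = opPow s B := by
  rw [powNear, hK, mul_sub, sub_mul, suppProj_mul_of_suppLE hB hBA, mul_suppProj_of_suppLE hB hBA,
    suppProj_mul hA, mul_suppProj hA, add_sub_cancel]

theorem powNear_zero (s : ℝ) (A : Op d) : powNear s A 0 = opPow s A := by
  simp [powNear]

/-- Young's inequality. -/
theorem young_weighted {s x y : ℝ} (hs0 : 0 < s) (hs1 : s < 1) (hx : 0 ≤ x) (hy : 0 ≤ y) :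
    x ^ s * y ^ (1 - s) ≤ s * x + (1 - s) * y :=
  Real.geom_mean_le_arith_mean2_weighted hs0.le (by linarith) hx hy (by ring)

/-- Young's inequality is reversed for `s > 1`: apply the weighted arithmetic-geometric mean
inequality with weights `s⁻¹, 1 - s⁻¹` to `x ^ s * y ^ (1 - s)` and `y`. -/
theorem reverse_young_weighted_of_one_lt {s x y : ℝ} (hs : 1 < s) (hx : 0 < x) (hy : 0 < y) :
    s * x + (1 - s) * y ≤ x ^ s * y ^ (1 - s) := by
  have hs0 : 0 < s := by linarith
  have h := Real.geom_mean_le_arith_mean2_weighted (w₁ := s⁻¹) (w₂ := 1 - s⁻¹)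
    (p₁ := x ^ s * y ^ (1 - s)) (p₂ := y) (by positivity)
    (by have := inv_le_one_of_one_le₀ hs.le; linarith) (by positivity) hy.le (by ring)
  rw [Real.mul_rpow (by positivity) (by positivity), ← Real.rpow_mul hx.le, ← Real.rpow_mul hy.le,
    mul_inv_cancel₀ hs0.ne', Real.rpow_one, mul_assoc, ← Real.rpow_add hy] at h
  have h0 : (1 - s) * s⁻¹ + (1 - s⁻¹) = 0 := by field_simp; ring
  rw [h0, Real.rpow_zero, mul_one] at h
  have h2 := mul_le_mul_of_nonneg_left h hs0.le
  have h3 : s * (s⁻¹ * (x ^ s * y ^ (1 - s)) + (1 - s⁻¹) * y)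
      = x ^ s * y ^ (1 - s) + (s - 1) * y := by field_simp
  linarith

theorem reverse_young_weighted {s x y : ℝ} (hs : s < 0 ∨ 1 < s) (hx : 0 < x) (hy : 0 < y) :
    s * x + (1 - s) * y ≤ x ^ s * y ^ (1 - s) := by
  rcases hs with hs | hs
  · have := reverse_young_weighted_of_one_lt (s := 1 - s) (by linarith) hy hx
    rw [sub_sub_cancel] at this
    linarith
  · exact reverse_young_weighted_of_one_lt hs hx hy

theorem posSemidef_cfc {X : Op d} (hX : X.IsHermitian) {f : ℝ → ℝ}
    (h : ∀ x ∈ spectrum ℝ X, 0 ≤ f x) : (cfc f X).PosSemidef := by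
  have hXs : IsSelfAdjoint X := hX
  have hc : (cfc f X).IsHermitian := cfc_predicate f X
  refine hc.posSemidef_iff_eigenvalues_nonneg.2 fun i => ?_
  have hi := hc.eigenvalues_mem_spectrum_real i
  rw [cfc_map_spectrum f X hXs (continuousOn_spectrum_op _ _)] at hi
  obtain ⟨x, hx, hxi⟩ := hi
  exact (h x hx).trans_eq hxi

/-- Klein-type inequality: a pointwise inequality between `f x * g y` and an affine function of
`(x, y)` on the spectra passes to traces. In an eigenbasis of `Y` it reduces to the diagonal entries
of one-variable functions of `X`. -/
theorem trace_cfc_mul_cfc_nonneg {X Y : Op d} (hX : X.IsHermitian) (hY : Y.IsHermitian)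
    {f g : ℝ → ℝ} {a b c : ℝ}
    (h : ∀ x ∈ spectrum ℝ X, ∀ y ∈ spectrum ℝ Y, 0 ≤ c * (f x * g y) + a * x + b * y) :
    0 ≤ c * (cfc f X * cfc g Y).trace.re + a * X.trace.re + b * Y.trace.re := by
  have hXs : IsSelfAdjoint X := hX
  set U : Op d := (hY.eigenvectorUnitary : Op d)
  have hUU : star U * U = 1 := Unitary.coe_star_mul_self _
  have hUU' : U * star U = 1 := Unitary.coe_mul_star_self _
  have hg : cfc g Y = U * Matrix.diagonal (fun i => ((g (hY.eigenvalues i) : ℝ) : ℂ)) * star U := by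
    rw [hY.cfc_eq, Matrix.IsHermitian.cfc, Unitary.conjStarAlgAut_apply]; rfl
  have hdiag : ∀ i, 0 ≤ (c * g (hY.eigenvalues i)) * ((star U * cfc f X * U) i i).re
      + a * ((star U * X * U) i i).re + b * hY.eigenvalues i := by
    intro i
    set y := hY.eigenvalues i
    have hM : cfc (fun x : ℝ => (c * g y) * f x + a * x + b * y) X
        = (c * g y) • cfc f X + a • X + (b * y) • 1 := by
      rw [cfc_add _ _ _ (continuousOn_spectrum_op _ _) (continuousOn_spectrum_op _ _),
        cfc_add _ _ _ (continuousOn_spectrum_op _ _) (continuousOn_spectrum_op _ _),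
        cfc_const_mul _ _ _ (continuousOn_spectrum_op _ _), cfc_const_mul_id _ _, cfc_const _ _,
        Algebra.algebraMap_eq_smul_one]
    have hpos : ((c * g y) • cfc f X + a • X + (b * y) • (1 : Op d)).PosSemidef := by
      rw [← hM]
      refine posSemidef_cfc hX fun x hx => ?_
      have := h x hx y (hY.eigenvalues_mem_spectrum_real i)
      rwa [mul_right_comm, mul_assoc] at *
    have h2 := (hpos.conjTranspose_mul_mul_same U).diag_nonneg (i := i)
    have h3 : U.conjTranspose * ((c * g y) • cfc f X + a • X + (b * y) • (1 : Op d)) * U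
        = (c * g y) • (star U * cfc f X * U) + a • (star U * X * U) + (b * y) • 1 := by
      have hUU2 : U.conjTranspose * U = 1 := hUU
      simp [mul_add, add_mul, Matrix.star_eq_conjTranspose, hUU2]
    rw [h3] at h2
    simpa using (Complex.le_def.1 h2).1
  have htr : ∀ (C : Op d) (v : Fin d → ℝ),
      (C * (U * Matrix.diagonal (fun i => ((v i : ℝ) : ℂ)) * star U)).trace.re
        = ∑ i, ((star U * C * U) i i).re * v i := by
    intro C v
    rw [← mul_assoc, Matrix.trace_mul_comm, ← mul_assoc, ← mul_assoc, Matrix.trace]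
    simp
  have hXt : X.trace = (star U * X * U).trace := by
    rw [Matrix.trace_mul_comm, ← mul_assoc, hUU', one_mul]
  have hYt : Y.trace.re = ∑ i, hY.eigenvalues i := by
    rw [hY.trace_eq_sum_eigenvalues]; simp
  rw [hg, htr, hXt, hYt, Matrix.trace]
  simp only [Complex.re_sum, Finset.mul_sum, ← Finset.sum_add_distrib, Matrix.diag_apply]
  refine Finset.sum_nonneg fun i _ => (hdiag i).trans_eq ?_
  ring

/-! ### The first-order trace identity and positivity of the overlap -/

/-- The real part of the trace, as a continuous real-linear functional. -/
noncomputable def traceRe : Op d →L[ℝ] ℝ :=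
  LinearMap.toContinuousLinearMap (Complex.reLm ∘ₗ Matrix.traceLinearMap (Fin d) ℝ ℂ)

theorem traceRe_apply (M : Op d) : traceRe M = M.trace.re := rfl

theorem hasFDerivAt_powNear {s : ℝ} (hs : s ≠ 0) {A : Op d} (hA : A.PosSemidef) :
    HasFDerivAt (powNear s A) (fderiv ℝ (powNear s A) 0) 0 :=
  ((contDiffAt_powNear hs hA).differentiableAt (by simp)).hasFDerivAt

/-- Both factors of `A ^ t (A + P K P) ^ s` may be moved to the positive definite base point
`A + (1 - P)`, at the cost of the constant `1 - P`. -/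
theorem opPow_mul_powNear {s t : ℝ} (hs : s ≠ 0) (ht : t ≠ 0) {A : Op d} (hA : A.PosSemidef)
    (K : Herm d) : opPow t A * powNear s A K
      = opPow t (A + (1 - suppProj A)) * opPow s (A + (1 - suppProj A) + compression A K)
        - (1 - suppProj A) := by
  have hP := suppProj_mul_self A
  have h1 := powNear_eq_sub ht hA 0
  rw [powNear_zero, map_zero, add_zero] at h1
  have hQ : (1 - suppProj A) * (1 - suppProj A) = 1 - suppProj A := by
    simp [mul_sub, sub_mul, hP]
  have h2 : (1 - suppProj A) * powNear s A K = 0 := by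
    refine mul_opPow_eq_zero ?_ hs ?_
    · rw [← compression_apply]
      exact IsSelfAdjoint.add hA.1 (compression_isSelfAdjoint A K)
    · simp only [mul_add, sub_mul, one_mul, suppProj_mul hA.1, ← mul_assoc, hP, sub_self, zero_mul,
        add_zero]
  have h3 : opPow t A * (1 - suppProj A) = 0 := by
    have h : (1 - suppProj A) * opPow t A = 0 :=
      mul_opPow_eq_zero hA.1 ht (by rw [sub_mul, one_mul, suppProj_mul hA.1, sub_self])
    have h' := congrArg star h
    rwa [star_mul, (opPow_isSelfAdjoint t A).star_eq, star_zero, star_sub, star_one,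
      (suppProj_isSelfAdjoint A).star_eq] at h'
  have h4 := powNear_eq_sub hs hA K
  have h5 : opPow t (A + (1 - suppProj A)) = opPow t A + (1 - suppProj A) := by
    rw [h1, sub_add_cancel]
  have h6 : opPow s (A + (1 - suppProj A) + compression A K)
      = powNear s A K + (1 - suppProj A) := by rw [h4, sub_add_cancel]
  rw [h5, h6, add_mul, mul_add, mul_add, h2, h3, hQ]
  simp

/-- First-order trace identity `Tr[A ^ (1 - s) D[A ^ s](K)] = s Tr[P K P]`, obtained from the local
extremality of the difference of both sides before differentiation. -/
theorem traceRe_opPow_mul_DPow {s : ℝ} (hs0 : s ≠ 0) (hs1 : s ≠ 1) {A : Op d}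
    (hA : A.PosSemidef) (K : Herm d) :
    traceRe (opPow (1 - s) A * DPow s A K) = s * traceRe (compression A K) := by
  have hs1' : 1 - s ≠ 0 := sub_ne_zero.2 hs1.symm
  set B : Op d := A + (1 - suppProj A) with hBdef
  have hB : B.PosDef := posDef_add_one_sub_suppProj hA
  obtain ⟨r, hr, hrB⟩ := exists_norm_smul_sub_one_lt hB
  have hcont : Continuous fun K : Herm d => ‖r⁻¹ • (B + compression A K) - 1‖ := by fun_prop
  have hev : ∀ᶠ K : Herm d in 𝓝 0, ‖r⁻¹ • (B + compression A K) - 1‖ < 1 := by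
    refine hcont.continuousAt.eventually_lt_const ?_
    simpa using hrB
  -- Young's inequality goes one way for `0 < s < 1` and the other way otherwise.
  obtain ⟨c, hc, hyoung⟩ : ∃ c : ℝ, c ≠ 0 ∧ ∀ x y : ℝ, 0 < x → 0 < y →
      0 ≤ c * (x ^ s * y ^ (1 - s)) + -(c * s) * x + -(c * (1 - s)) * y := by
    by_cases h01 : 0 < s ∧ s < 1
    · exact ⟨-1, by norm_num, fun x y hx hy => by
        linarith [young_weighted h01.1 h01.2 hx.le hy.le]⟩
    · have h : s < 0 ∨ 1 < s := by
        rcases lt_or_gt_of_ne hs0 with h | h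
        · exact .inl h
        · exact .inr (lt_of_le_of_ne (not_lt.1 fun h' => h01 ⟨h, h'⟩) hs1.symm)
      exact ⟨1, one_ne_zero, fun x y hx hy => by linarith [reverse_young_weighted h hx hy]⟩
  let f : Herm d → ℝ := fun K => c * (traceRe (opPow (1 - s) A * powNear s A K)
    - s * traceRe (compression A K))
  have hmin : IsLocalMin f 0 := by
    filter_upwards [hev] with K hK
    have hX : IsSelfAdjoint (B + compression A K) :=
      IsSelfAdjoint.add hB.1 (compression_isSelfAdjoint A K)
    have h := trace_cfc_mul_cfc_nonneg (X := B + compression A K) (Y := B) hX hB.1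
      (f := fun x => x ^ s) (g := fun y => y ^ (1 - s)) (a := -(c * s)) (b := -(c * (1 - s)))
      (c := c) fun x hx y hy => hyoung x y (spectrum_pos_of_norm_lt_one hX hr hK hx)
        ((posDef_iff_spectrum_pos hB.1).1 hB y hy)
    have h0 : opPow (1 - s) A * powNear s A 0 = A := by
      rw [powNear_zero, opPow_mul_opPow hA (by simp), sub_add_cancel, opPow_one hA.1]
    have h1 : traceRe B = traceRe A + traceRe (1 - suppProj A) := by rw [hBdef, map_add]
    have h2 := Matrix.trace_mul_comm (opPow s (B + compression A K)) (opPow (1 - s) B)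
    change 0 ≤ c * (opPow s (B + compression A K) * opPow (1 - s) B).trace.re + _ + _ at h
    rw [h2, ← traceRe_apply, ← traceRe_apply, ← traceRe_apply, map_add, h1] at h
    have hf0 : f 0 = c * traceRe A := by simp [f, h0]
    change f 0 ≤ f K
    rw [hf0]
    simp only [f]
    rw [opPow_mul_powNear hs0 hs1' hA, map_sub, ← hBdef]
    linarith
  have hderiv : HasFDerivAt f (c • ((traceRe.comp (ContinuousLinearMap.mul ℝ (Op d)
      (opPow (1 - s) A))).comp (fderiv ℝ (powNear s A) 0)
      - s • traceRe.comp (compression A))) 0 := by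
    refine HasFDerivAt.const_mul (HasFDerivAt.sub ?_ ?_) c
    · exact (ContinuousLinearMap.hasFDerivAt (traceRe.comp (ContinuousLinearMap.mul ℝ (Op d)
        (opPow (1 - s) A)))).comp (0 : Herm d) (hasFDerivAt_powNear hs0 hA)
    · exact (ContinuousLinearMap.hasFDerivAt (traceRe.comp (compression A))).const_mul s
  have h := congrArg (fun L : Herm d →L[ℝ] ℝ => L K) (hmin.hasFDerivAt_eq_zero hderiv)
  simpa [hc, sub_eq_zero, DPow] using h

/-- The overlap is the squared Hilbert-Schmidt norm of `ρ ^ (s / 2) σ ^ (t / 2)`; if it vanished,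
then `ρ σ = 0`, which `ρ ≪ σ` excludes for `ρ ≠ 0`. -/
theorem trace_re_opPow_mul_opPow_pos {ρ σ : Op d} (hρ : ρ.PosSemidef) (hσ : σ.PosSemidef)
    (hρσ : SuppLE ρ σ) (hρ0 : ρ ≠ 0) {s t : ℝ} (hs : s ≠ 0) (ht : t ≠ 0) :
    0 < (opPow s ρ * opPow t σ).trace.re := by
  set M := opPow (s / 2) ρ
  set N := opPow (t / 2) σ
  have hM : opPow s ρ = M * M := by
    rw [opPow_mul_opPow hρ (by simpa using hs), add_halves]
  have hN : opPow t σ = N * N := by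
    rw [opPow_mul_opPow hσ (by simpa using ht), add_halves]
  have hMs : star M = M := opPow_isSelfAdjoint _ _
  have hNs : star N = N := opPow_isSelfAdjoint _ _
  have htr : (opPow s ρ * opPow t σ).trace = ((M * N).conjTranspose * (M * N)).trace := by
    rw [← Matrix.star_eq_conjTranspose, star_mul, hMs, hNs, hM, hN, ← mul_assoc,
      Matrix.trace_mul_comm]
    simp only [mul_assoc]
  have hnn : 0 ≤ ((M * N).conjTranspose * (M * N)).trace :=
    (Matrix.posSemidef_conjTranspose_mul_self _).trace_nonneg
  have hne : ((M * N).conjTranspose * (M * N)).trace ≠ 0 := by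
    rw [Ne, Matrix.trace_conjTranspose_mul_self_eq_zero_iff]
    intro h
    have h1 : M * σ = 0 := by
      have : N * opPow (1 - t / 2) σ = σ := by
        rw [opPow_mul_opPow hσ (by simp), add_sub_cancel, opPow_one hσ.1]
      rw [← this, ← mul_assoc, h, zero_mul]
    have h2 : ρ * σ = 0 := by
      have : opPow (1 - s / 2) ρ * M = ρ := by
        rw [opPow_mul_opPow hρ (by simp), sub_add_cancel, opPow_one hρ.1]
      rw [← this, mul_assoc, h1, mul_zero]
    have h3 : σ * ρ = 0 := by
      have := congrArg star h2
      rwa [star_mul, show star ρ = ρ from hρ.1, show star σ = σ from hσ.1, star_zero] at this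
    exact hρ0 (by rw [← suppProj_mul_of_suppLE hρ.1 hρσ, suppProj_mul_eq_zero h3])
  rw [htr]
  exact (Complex.lt_def.1 (lt_of_le_of_ne hnn hne.symm)).1

/-! ### Measurability of powers, rescaled limits and products of expansions -/

/-- The Hermitian part `(M + M⋆) / 2` of an operator. Composing with it extends functions of
Hermitian operators to all operators, where the random variables take their values. -/
noncomputable def hermPart : Op d →L[ℝ] Herm d :=
  LinearMap.toContinuousLinearMap (LinearMap.codRestrict (selfAdjoint.submodule ℝ (Op d))
    (((2 : ℝ)⁻¹) • (LinearMap.id + (starLinearEquiv ℝ (A := Op d)).toLinearMap)) fun M => by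
      change IsSelfAdjoint ((2 : ℝ)⁻¹ • (M + star M))
      exact (IsSelfAdjoint.all (2 : ℝ)⁻¹).smul (IsSelfAdjoint.add_star_self M))

theorem coe_hermPart {M : Op d} (hM : IsSelfAdjoint M) : (hermPart M : Op d) = M := by
  change (2 : ℝ)⁻¹ • (M + star M) = M
  rw [hM.star_eq, ← two_smul ℝ M, inv_smul_smul₀ two_ne_zero]

theorem hermPart_coe (K : Herm d) : hermPart (K : Op d) = K :=
  Subtype.ext (coe_hermPart K.2)

/-- For `s < 0` the power is discontinuous where the rank drops, but it is a pointwise limit of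
functional calculi of continuous functions. -/
theorem measurable_opPow {Ω : Type*} [MeasurableSpace Ω] {s : ℝ} (hs : s ≠ 0) {X : Ω → Op d}
    (hX : Measurable X) (hpos : ∀ ω, (X ω).PosSemidef) : Measurable fun ω => opPow s (X ω) := by
  -- `|x|` and the shift keep the base of the power positive, so `g k` is continuous on `ℝ`; the
  -- second factor makes it vanish at `0`.
  let g : ℕ → ℝ → ℝ := fun k x => (|x| + 1 / ((k : ℝ) + 1)) ^ s * (|x| / (|x| + 1 / ((k : ℝ) + 1)))
  have hk : ∀ k : ℕ, (0 : ℝ) < 1 / ((k : ℝ) + 1) := fun k => by positivity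
  have hne : ∀ (k : ℕ) (x : ℝ), |x| + 1 / ((k : ℝ) + 1) ≠ 0 := fun k x =>
    (add_pos_of_nonneg_of_pos (abs_nonneg x) (hk k)).ne'
  have hg : ∀ k, Continuous (g k) := fun k =>
    ((continuous_abs.add_const _).rpow_const fun x => .inl (hne k x)).mul
      (continuous_abs.div (continuous_abs.add_const _) (hne k))
  have hmeas : ∀ k, Measurable fun ω => cfc (g k) (X ω) := by
    intro k
    have hc : Continuous fun M : Op d => cfc (g k) (hermPart M : Op d) :=
      Continuous.cfc_of_mem_nhdsSet (s := Set.univ) (g k) Filter.univ_mem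
        (continuous_subtype_val.comp hermPart.continuous) (fun M => (hermPart M).2)
        (hg k).continuousOn
    have h1 := hc.measurable.comp hX
    have h2 : (fun ω => cfc (g k) (X ω)) = (fun M : Op d => cfc (g k) (hermPart M : Op d)) ∘ X := by
      ext1 ω
      simp [coe_hermPart (hpos ω).1.isSelfAdjoint]
    rwa [h2]
  refine measurable_of_tendsto_metrizable hmeas (tendsto_pi_nhds.2 fun ω => ?_)
  refine tendsto_cfc_fun ?_ (Eventually.of_forall fun k => (hg k).continuousOn)
  rw [Metric.tendstoUniformlyOn_iff]
  refine fun ε hε => (eventually_all_finite Matrix.finite_real_spectrum).2 fun x hx => ?_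
  have hx0 := spectrum_nonneg_of_posSemidef (hpos ω) hx
  suffices h : Tendsto (fun k => g k x) atTop (𝓝 (x ^ s)) by
    simpa only [dist_comm] using Metric.tendsto_nhds.1 h ε hε
  rcases hx0.eq_or_lt with rfl | hx0
  · simp [g, Real.zero_rpow hs]
  · have h0 : Tendsto (fun k : ℕ => |x| + 1 / ((k : ℝ) + 1)) atTop (𝓝 x) := by
      simpa [abs_of_pos hx0] using
        (tendsto_one_div_add_atTop_nhds_zero_nat (𝕜 := ℝ)).const_add |x|
    simpa [g, abs_of_pos hx0, hx0.ne'] using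
      (h0.rpow_const (.inl hx0.ne')).mul ((tendsto_const_nhds (x := |x|)).div h0 hx0.ne')

/-- A function with leading term `q`, homogeneous of degree `k`, rescales to `q` uniformly on
balls. -/
theorem tendstoUniformlyOn_rescale {E : Type*} [NormedAddCommGroup E] [NormedSpace ℝ E]
    {G q : E → ℝ} {k : ℕ} (hGq : (fun x => G x - q x) =o[𝓝 0] fun x => ‖x‖ ^ k)
    (hq : ∀ (c : ℝ) x, q (c • x) = c ^ k * q x) {r : ℕ → ℝ} (hr_pos : ∀ n, 0 < r n)
    (hr : Tendsto r atTop atTop) (M : ℝ) :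
    TendstoUniformlyOn (fun n x => r n ^ k * G ((r n)⁻¹ • x)) q atTop (Metric.closedBall 0 M) := by
  rw [Metric.tendstoUniformlyOn_iff]
  intro ε hε
  -- A positive radius, as `M` is arbitrary.
  set M' : ℝ := |M| + 1
  have hM' : 0 < M' := by positivity
  have hMM' : M ≤ M' := (le_abs_self M).trans (by simp [M'])
  have hη : 0 < ε / (2 * M' ^ k) := by positivity
  obtain ⟨δ, hδ, hball⟩ := Metric.eventually_nhds_iff_ball.1 ((isLittleO_iff.1 hGq) hη)
  filter_upwards [hr.eventually_gt_atTop (M' / δ)] with n hn x hx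
  have hrn := hr_pos n
  have hx' : ‖x‖ ≤ M' := (mem_closedBall_zero_iff.1 hx).trans hMM'
  have hnorm : ‖(r n)⁻¹ • x‖ = ‖x‖ / r n := by
    rw [norm_smul, norm_inv, Real.norm_of_nonneg hrn.le, inv_mul_eq_div]
  have hmem : (r n)⁻¹ • x ∈ Metric.ball (0 : E) δ := by
    rw [mem_ball_zero_iff, hnorm, div_lt_iff₀ hrn]
    rw [div_lt_iff₀ hδ] at hn
    linarith
  have h1 := hball _ hmem
  rw [hq, Real.norm_eq_abs, Real.norm_eq_abs, hnorm,
    abs_of_nonneg (by positivity : 0 ≤ (‖x‖ / r n) ^ k), div_pow] at h1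
  have h2 : q x - r n ^ k * G ((r n)⁻¹ • x)
      = -(r n ^ k * (G ((r n)⁻¹ • x) - (r n)⁻¹ ^ k * q x)) := by
    have : r n ^ k * (r n)⁻¹ ^ k = 1 := by rw [← mul_pow, mul_inv_cancel₀ hrn.ne', one_pow]
    linear_combination (-q x) * this
  rw [Real.dist_eq, h2, abs_neg, abs_mul, abs_of_pos (by positivity : 0 < r n ^ k)]
  calc r n ^ k * |G ((r n)⁻¹ • x) - (r n)⁻¹ ^ k * q x|
      ≤ r n ^ k * (ε / (2 * M' ^ k) * (‖x‖ ^ k / r n ^ k)) := by gcongr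
    _ = ε / 2 * (‖x‖ ^ k / M' ^ k) := by field_simp
    _ ≤ ε / 2 * 1 := by
        gcongr
        exact div_le_one_of_le₀ (by gcongr) (by positivity)
    _ < ε := by linarith

/-- The product of two second-order expansions is the second-order expansion of the product. -/
theorem isLittleO_mul_sub_taylor_two {E 𝔸 : Type*} [NormedAddCommGroup E] [NormedRing 𝔸]
    {f g f₁ g₁ f₂ g₂ : E → 𝔸} {f₀ g₀ : 𝔸}
    (hf : (fun x => f x - f₀ - f₁ x - f₂ x) =o[𝓝 0] fun x => ‖x‖ ^ 2)
    (hg : (fun x => g x - g₀ - g₁ x - g₂ x) =o[𝓝 0] fun x => ‖x‖ ^ 2)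
    (hf₁ : f₁ =O[𝓝 0] fun x => ‖x‖) (hg₁ : g₁ =O[𝓝 0] fun x => ‖x‖)
    (hf₂ : f₂ =O[𝓝 0] fun x => ‖x‖ ^ 2) (hg₂ : g₂ =O[𝓝 0] fun x => ‖x‖ ^ 2) :
    (fun x => f x * g x - f₀ * g₀ - (f₁ x * g₀ + f₀ * g₁ x)
      - (f₂ x * g₀ + f₀ * g₂ x + f₁ x * g₁ x)) =o[𝓝 0] fun x => ‖x‖ ^ 2 := by
  have hn : (fun x : E => ‖x‖) =o[𝓝 0] fun _ => (1 : ℝ) := by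
    rw [isLittleO_one_iff]; simpa using (continuous_norm (E := E)).tendsto 0
  have hn2 : (fun x : E => ‖x‖ ^ 2) =o[𝓝 0] fun _ => (1 : ℝ) := by
    simpa using hn.pow two_pos
  have hc : ∀ c : 𝔸, (fun _ : E => c) =O[𝓝 0] fun _ => (1 : ℝ) := fun c =>
    isBigO_const_const c one_ne_zero _
  have hgO : g =O[𝓝 0] fun _ => (1 : ℝ) := by
    have := (((hg.trans hn2).isBigO.add (hg₂.trans hn2.isBigO)).add (hg₁.trans hn.isBigO)).add
      (hc g₀)
    refine this.congr_left fun x => ?_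
    abel
  have hpO : (fun x => f₀ + f₁ x + f₂ x) =O[𝓝 0] fun _ => (1 : ℝ) :=
    ((hc f₀).add (hf₁.trans hn.isBigO)).add (hf₂.trans hn2.isBigO)
  have t1 := hf.mul_isBigO hgO
  have t2 := hpO.mul_isLittleO hg
  have t3 := (hf₁.trans_isLittleO hn).mul_isBigO hg₂
  have t4 := hf₂.mul_isLittleO (hg₁.trans_isLittleO hn)
  have t5 := hf₂.mul_isLittleO (hg₂.trans_isLittleO hn2)
  simp only [mul_one, one_mul] at t1 t2 t3 t4 t5
  refine ((((t1.add t2).add t3).add t4).add t5).congr_left fun x => ?_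
  noncomm_ring

/-! ### Expansion of the overlap and of its logarithm -/

/-- The overlap `Tr[(ρ + P K₁ P) ^ α (σ + P' K₂ P') ^ (1 - α)]` as a function of the increments,
where `K₁` and `K₂` are the Hermitian parts of the components of `x` and `P`, `P'` the support
projections of `ρ`, `σ`. -/
noncomputable def overlap (α : ℝ) (ρ σ : Op d) (x : Op d × Op d) : ℝ :=
  traceRe (powNear α ρ (hermPart x.1) * powNear (1 - α) σ (hermPart x.2))

/-- The derivative of the overlap at zero increments. -/
noncomputable def overlapDeriv (α : ℝ) (ρ σ : Op d) : Op d × Op d →L[ℝ] ℝ :=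
  traceRe.comp
    ((ContinuousLinearMap.mul ℝ (Op d) (opPow α ρ)).comp
        ((fderiv ℝ (powNear (1 - α) σ) 0).comp (hermPart.comp (ContinuousLinearMap.snd ℝ _ _)))
      + ((ContinuousLinearMap.mul ℝ (Op d)).flip (opPow (1 - α) σ)).comp
        ((fderiv ℝ (powNear α ρ) 0).comp (hermPart.comp (ContinuousLinearMap.fst ℝ _ _))))

theorem overlapDeriv_apply (α : ℝ) (ρ σ : Op d) (x : Op d × Op d) :
    overlapDeriv α ρ σ x = traceRe (opPow (1 - α) σ * DPow α ρ (hermPart x.1))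
      + traceRe (opPow α ρ * DPow (1 - α) σ (hermPart x.2)) := by
  have h : traceRe (opPow (1 - α) σ * DPow α ρ (hermPart x.1))
      = traceRe (DPow α ρ (hermPart x.1) * opPow (1 - α) σ) := by
    rw [traceRe_apply, traceRe_apply, Matrix.trace_mul_comm]
  rw [h, add_comm, ← map_add]
  rfl

/-- The quadratic form of the second derivative of the overlap at zero increments. -/
noncomputable def overlapHess (α : ℝ) (ρ σ : Op d) (x : Op d × Op d) : ℝ :=
  traceRe (opPow (1 - α) σ * D2Pow α ρ (hermPart x.1) (hermPart x.1)
    + opPow α ρ * D2Pow (1 - α) σ (hermPart x.2) (hermPart x.2)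
    + 2 * (DPow α ρ (hermPart x.1) * DPow (1 - α) σ (hermPart x.2)))

theorem continuous_overlapHess (α : ℝ) (ρ σ : Op d) : Continuous (overlapHess α ρ σ) := by
  unfold overlapHess D2Pow DPow
  fun_prop

theorem overlapHess_smul (α : ℝ) (ρ σ : Op d) (c : ℝ) (x : Op d × Op d) :
    overlapHess α ρ σ (c • x) = c ^ 2 * overlapHess α ρ σ x := by
  rw [← smul_eq_mul, overlapHess, overlapHess, ← map_smul]
  congr 1
  simp only [D2Pow, DPow, Prod.smul_fst, Prod.smul_snd, map_smul, smul_apply,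
    smul_add, smul_smul, mul_smul_comm, smul_mul_assoc, pow_two]

theorem overlap_zero (α : ℝ) (ρ σ : Op d) :
    overlap α ρ σ 0 = traceRe (opPow α ρ * opPow (1 - α) σ) := by
  simp [overlap, powNear_zero]

theorem isLittleO_powNear_hermPart {s : ℝ} (hs : s ≠ 0) {A : Op d} (hA : A.PosSemidef)
    (p : Op d × Op d →L[ℝ] Op d) :
    (fun x => powNear s A (hermPart (p x)) - opPow s A - DPow s A (hermPart (p x))
      - (1 / 2 : ℝ) • D2Pow s A (hermPart (p x)) (hermPart (p x))) =o[𝓝 0] fun x => ‖x‖ ^ 2 := by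
  have h := isLittleO_sub_taylor_two (twiceDiffPow hs hA).1 (twiceDiffPow hs hA).2
  rw [powNear_zero] at h
  have ht : Tendsto (hermPart.comp p) (𝓝 0) (𝓝 0) := by
    simpa using (hermPart.comp p).continuous.tendsto 0
  exact (h.comp_tendsto ht).trans_isBigO
    (((hermPart.comp p).isBigO_id (𝓝 0)).norm_norm.pow 2)

theorem isBigO_DPow {s : ℝ} {A : Op d} (p : Op d × Op d →L[ℝ] Op d) :
    (fun x => DPow s A (hermPart (p x))) =O[𝓝 0] fun x => ‖x‖ :=
  (((fderiv ℝ (powNear s A) 0).comp (hermPart.comp p)).isBigO_id (𝓝 0)).norm_right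

theorem isBigO_D2Pow {s : ℝ} {A : Op d} (p : Op d × Op d →L[ℝ] Op d) :
    (fun x => D2Pow s A (hermPart (p x)) (hermPart (p x))) =O[𝓝 0] fun x => ‖x‖ ^ 2 := by
  have h := (isBigO_fderiv_fderiv (powNear s A) ⊤).comp_tendsto
    (tendsto_top : Tendsto (fun x => hermPart (p x)) (𝓝 0) ⊤)
  exact h.trans (((hermPart.comp p).isBigO_id (𝓝 0)).norm_norm.pow 2)

theorem isBigO_overlapHess (α : ℝ) (ρ σ : Op d) :
    overlapHess α ρ σ =O[𝓝 0] fun x => ‖x‖ ^ 2 := by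
  have hc : ∀ C : Op d, (fun _ : Op d × Op d => C) =O[𝓝 0] fun _ => (1 : ℝ) := fun C =>
    isBigO_const_const C one_ne_zero _
  have h1 := (hc (opPow (1 - α) σ)).mul
    (isBigO_D2Pow (s := α) (A := ρ) (ContinuousLinearMap.fst ℝ _ _))
  have h2 := (hc (opPow α ρ)).mul
    (isBigO_D2Pow (s := 1 - α) (A := σ) (ContinuousLinearMap.snd ℝ _ _))
  have h3 := (hc 2).mul ((isBigO_DPow (s := α) (A := ρ) (ContinuousLinearMap.fst ℝ _ _)).mul
    (isBigO_DPow (s := 1 - α) (A := σ) (ContinuousLinearMap.snd ℝ _ _)))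
  simp only [one_mul, ← pow_two] at h1 h2 h3
  exact (traceRe.isBigO_comp _ _).trans ((h1.add h2).add h3)

theorem isLittleO_overlap {α : ℝ} (h0 : α ≠ 0) (h1 : α ≠ 1) {ρ σ : Op d} (hρ : ρ.PosSemidef)
    (hσ : σ.PosSemidef) :
    (fun x => overlap α ρ σ x - overlap α ρ σ 0 - overlapDeriv α ρ σ x
      - 1 / 2 * overlapHess α ρ σ x) =o[𝓝 0] fun x => ‖x‖ ^ 2 := by
  have h1' : 1 - α ≠ 0 := sub_ne_zero.2 h1.symm
  have h := isLittleO_mul_sub_taylor_two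
    (isLittleO_powNear_hermPart h0 hρ (ContinuousLinearMap.fst ℝ _ _))
    (isLittleO_powNear_hermPart h1' hσ (ContinuousLinearMap.snd ℝ _ _))
    (isBigO_DPow _) (isBigO_DPow _) ((isBigO_D2Pow _).const_smul_left (1 / 2 : ℝ))
    ((isBigO_D2Pow _).const_smul_left (1 / 2 : ℝ))
  refine ((traceRe.isBigO_comp _ _).trans_isLittleO h).congr_left fun x => ?_
  have hc : ∀ M N : Op d, traceRe (M * N) = traceRe (N * M) := fun M N => by
    rw [traceRe_apply, traceRe_apply, Matrix.trace_mul_comm]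
  rw [overlap_zero]
  simp only [ContinuousLinearMap.coe_fst', ContinuousLinearMap.coe_snd', map_sub, map_add,
    overlapDeriv_apply, overlapHess, overlap, smul_mul_assoc, mul_smul_comm,
    map_smul, smul_eq_mul, two_mul]
  rw [hc (DPow α ρ _) (opPow _ _), hc (D2Pow α ρ _ _) (opPow _ _)]
  ring

theorem hasFDerivAt_overlap {α : ℝ} (h0 : α ≠ 0) (h1 : α ≠ 1) {ρ σ : Op d} (hρ : ρ.PosSemidef)
    (hσ : σ.PosSemidef) : HasFDerivAt (overlap α ρ σ) (overlapDeriv α ρ σ) 0 := by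
  have hcomp : ∀ {s : ℝ} (_ : s ≠ 0) {A : Op d} (_ : A.PosSemidef)
      (p : Op d × Op d →L[ℝ] Op d), HasFDerivAt (fun x => powNear s A (hermPart (p x)))
        ((fderiv ℝ (powNear s A) 0).comp (hermPart.comp p)) 0 := by
    intro s hs A hA p
    refine HasFDerivAt.comp (g := powNear s A) (f := hermPart.comp p) 0 ?_
      (hermPart.comp p).hasFDerivAt
    rw [map_zero]
    exact hasFDerivAt_powNear hs hA
  have h := traceRe.hasFDerivAt.comp (0 : Op d × Op d)
    ((hcomp h0 hρ (ContinuousLinearMap.fst ℝ _ _)).mul'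
      (hcomp (sub_ne_zero.2 h1.symm) hσ (ContinuousLinearMap.snd ℝ _ _)))
  refine h.congr_fderiv (ContinuousLinearMap.ext fun x => ?_)
  simp [overlapDeriv, powNear_zero]

theorem isLittleO_log_overlap {α : ℝ} (h0 : α ≠ 0) (h1 : α ≠ 1) {ρ σ : Op d} (hρ : ρ.PosSemidef)
    (hσ : σ.PosSemidef) (hpos : 0 < overlap α ρ σ 0) :
    (fun x => Real.log (overlap α ρ σ x) - Real.log (overlap α ρ σ 0)
      - overlapDeriv α ρ σ x / overlap α ρ σ 0) =o[𝓝 0] fun x => ‖x‖ ^ 1 := by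
  have hF := hasFDerivAt_overlap h0 h1 hρ hσ
  have := (hF.log hpos.ne').isLittleO
  simp only [sub_zero, pow_one]  at this ⊢
  refine (this.congr_left fun x => ?_).norm_right
  simp [div_eq_inv_mul]

/-- With the first-order term removed from inside the logarithm, the logarithm of the overlap is
quadratic to leading order. -/
theorem isLittleO_log_overlap_sub {α : ℝ} (h0 : α ≠ 0) (h1 : α ≠ 1) {ρ σ : Op d}
    (hρ : ρ.PosSemidef) (hσ : σ.PosSemidef) (hone : overlap α ρ σ 0 = 1) :
    (fun x => Real.log (overlap α ρ σ x - overlapDeriv α ρ σ x) - 1 / 2 * overlapHess α ρ σ x)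
      =o[𝓝 0] fun x => ‖x‖ ^ 2 := by
  have h := isLittleO_overlap h0 h1 hρ hσ
  rw [hone] at h
  have hHess : (fun x => 1 / 2 * overlapHess α ρ σ x) =O[𝓝 0] fun x => ‖x‖ ^ 2 :=
    (isBigO_overlapHess α ρ σ).const_mul_left _
  have hu : (fun x => overlap α ρ σ x - overlapDeriv α ρ σ x - 1) =O[𝓝 0] fun x => ‖x‖ ^ 2 :=
    (h.isBigO.add hHess).congr_left fun x => by ring
  have hlog : (fun u : ℝ => Real.log (1 + u) - u) =o[𝓝 0] fun u => u := by
    have := (Real.hasDerivAt_log one_ne_zero).isLittleO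
    rw [← map_add_left_nhds_zero, isLittleO_map] at this
    simpa [Function.comp_def] using this
  have ht : Tendsto (fun x => overlap α ρ σ x - overlapDeriv α ρ σ x - 1) (𝓝 0) (𝓝 0) := by
    refine hu.trans_tendsto ?_
    simpa using ((continuous_norm (E := Op d × Op d)).tendsto 0).pow 2
  refine (((hlog.comp_tendsto ht).trans_isBigO hu).add h).congr_left fun x => ?_
  simp only [Function.comp_apply, add_sub_cancel]
  ring

/-! ### Divergences of density operators -/

theorem IsDensity.ne_zero {ρ : Op d} (hρ : IsDensity ρ) : ρ ≠ 0 := by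
  rintro rfl
  simpa using hρ.2

theorem petzRenyi_toReal_of_suppLE (α : ℝ) {ρ σ : Op d} (h : SuppLE ρ σ) :
    (petzRenyi α ρ σ).toReal
      = 1 / (α - 1) * Real.log (traceRe (opPow α ρ * opPow (1 - α) σ)) := by
  rw [petzRenyi, if_pos (.inl h), EReal.toReal_coe, traceRe_apply]

theorem overlap_sub {α : ℝ} {ρ σ ρ' σ' : Op d} (hρ : ρ.IsHermitian) (hσ : σ.IsHermitian)
    (hρ' : ρ'.IsHermitian) (hσ' : σ'.IsHermitian) (h₁ : SuppLE ρ' ρ) (h₂ : SuppLE σ' σ) :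
    overlap α ρ σ (ρ' - ρ, σ' - σ) = traceRe (opPow α ρ' * opPow (1 - α) σ') := by
  rw [overlap, powNear_sub hρ hρ' h₁ (coe_hermPart (hρ'.sub hρ)),
    powNear_sub hσ hσ' h₂ (coe_hermPart (hσ'.sub hσ))]

theorem overlap_zero_of_self {α : ℝ} {ρ : Op d} (hρ : IsDensity ρ) : overlap α ρ ρ 0 = 1 := by
  rw [overlap_zero, opPow_mul_opPow hρ.1 (by simp), add_sub_cancel, opPow_one hρ.1.1,
    traceRe_apply, hρ.2, Complex.one_re]

theorem compression_hermPart_sub {A B : Op d} (hA : A.IsHermitian) (hB : B.IsHermitian)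
    (h : SuppLE B A) : compression A (hermPart (B - A)) = B - A := by
  rw [compression_apply, coe_hermPart (hB.sub hA), mul_sub, sub_mul, suppProj_mul_of_suppLE hB h,
    mul_suppProj_of_suppLE hB h, suppProj_mul hA, mul_suppProj hA]

/-- In the null case the first derivative is `α Tr + (1 - α) Tr` on the two increments, so it
vanishes on differences of density operators. -/
theorem overlapDeriv_self_sub {α : ℝ} (h0 : α ≠ 0) (h1 : α ≠ 1) {ρ ρ' σ' : Op d}
    (hρ : IsDensity ρ) (hρ' : IsDensity ρ') (hσ' : IsDensity σ') (h₁ : SuppLE ρ' ρ)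
    (h₂ : SuppLE σ' ρ) : overlapDeriv α ρ ρ (ρ' - ρ, σ' - ρ) = 0 := by
  have h3 := traceRe_opPow_mul_DPow (sub_ne_zero.2 h1.symm) (s := 1 - α) (by simpa using h0) hρ.1
    (hermPart (σ' - ρ))
  rw [sub_sub_cancel] at h3
  have ht : ∀ τ : Op d, IsDensity τ → traceRe (τ - ρ) = 0 := fun τ hτ => by
    rw [traceRe_apply, Matrix.trace_sub, hτ.2, hρ.2, sub_self, Complex.zero_re]
  rw [overlapDeriv_apply, traceRe_opPow_mul_DPow h0 h1 hρ.1, h3,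
    compression_hermPart_sub hρ.1.1 hρ'.1.1 h₁, compression_hermPart_sub hρ.1.1 hσ'.1.1 h₂,
    ht _ hρ', ht _ hσ']
  simp

end QDiv

theorem theorem2 {d : ℕ} {Ω Ω' : Type*} [MeasurableSpace Ω] [MeasurableSpace Ω']
    (P : Measure Ω) [IsProbabilityMeasure P] (P' : Measure Ω') [IsProbabilityMeasure P']
    (α : ℝ) (hα : α ∈ Set.Ioo (0 : ℝ) 1 ∪ Set.Ioc (1 : ℝ) 2)
    (ρ σ : QDiv.Op d) (hρ : QDiv.IsDensity ρ) (hσ : QDiv.IsDensity σ)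
    (ρn σn : ℕ → Ω → QDiv.Op d)
    (hρn_meas : ∀ n, Measurable (ρn n)) (hσn_meas : ∀ n, Measurable (σn n))
    (hρn : ∀ n ω, QDiv.IsDensity (ρn n ω)) (hσn : ∀ n ω, QDiv.IsDensity (σn n ω))
    (hρnσn : ∀ n, ∀ᵐ ω ∂P, QDiv.SuppLE (ρn n ω) (σn n ω))
    (hσnσ : ∀ n, ∀ᵐ ω ∂P, QDiv.SuppLE (σn n ω) σ)
    (hρnρ : ∀ n, ∀ᵐ ω ∂P, QDiv.SuppLE (ρn n ω) ρ)
    (hρσ : QDiv.SuppLE ρ σ)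
    (r : ℕ → ℝ) (hr_pos : ∀ n, 0 < r n) (hr : Tendsto r atTop atTop)
    (L₁ L₂ : Ω' → QDiv.Herm d) :
    -- the Fréchet derivatives below exist
    (QDiv.TwiceDiffPow α ρ ∧ QDiv.TwiceDiffPow (1 - α) σ) ∧
    -- two-sample alternative
    (TendstoInDistribution
        (fun n ω => (r n • (ρn n ω - ρ), r n • (σn n ω - σ))) atTop
        (fun ω => ((L₁ ω : QDiv.Op d), (L₂ ω : QDiv.Op d))) (fun _ => P) P' →
      TendstoInDistribution
        (fun n ω => r n * ((QDiv.petzRenyi α (ρn n ω) (σn n ω)).toReal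
          - (QDiv.petzRenyi α ρ σ).toReal)) atTop
        (fun ω =>
          ((QDiv.opPow (1 - α) σ * QDiv.DPow α ρ (L₁ ω)).trace.re
            + (QDiv.opPow α ρ * QDiv.DPow (1 - α) σ (L₂ ω)).trace.re)
          / ((α - 1) * (QDiv.opPow α ρ * QDiv.opPow (1 - α) σ).trace.re))
        (fun _ => P) P') ∧
    -- two-sample null
    (ρ = σ →
      TendstoInDistribution
        (fun n ω => (r n • (ρn n ω - ρ), r n • (σn n ω - ρ))) atTop
        (fun ω => ((L₁ ω : QDiv.Op d), (L₂ ω : QDiv.Op d))) (fun _ => P) P' →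
      TendstoInDistribution
        (fun n ω => r n ^ 2 * (QDiv.petzRenyi α (ρn n ω) (σn n ω)).toReal) atTop
        (fun ω =>
          (QDiv.opPow (1 - α) ρ * QDiv.D2Pow α ρ (L₁ ω) (L₁ ω)
            + QDiv.opPow α ρ * QDiv.D2Pow (1 - α) ρ (L₂ ω) (L₂ ω)
            + 2 * (QDiv.DPow α ρ (L₁ ω) * QDiv.DPow (1 - α) ρ (L₂ ω))).trace.re
          / (2 * (α - 1)))
        (fun _ => P) P') := by
  have h0 : α ≠ 0 := by
    rcases hα with h | h
    · exact h.1.ne'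
    · exact (zero_lt_one.trans h.1).ne'
  have h1 : α ≠ 1 := by
    rcases hα with h | h
    · exact h.2.ne
    · exact h.1.ne'
  have h1' : 1 - α ≠ 0 := sub_ne_zero.2 h1.symm
  have hα1 : α - 1 ≠ 0 := sub_ne_zero.2 h1
  -- Almost surely the divergence is finite, so it agrees with a measurable function.
  have hmeas : ∀ n, AEMeasurable (fun ω => (QDiv.petzRenyi α (ρn n ω) (σn n ω)).toReal) P := by
    intro n
    have hm : Measurable fun ω => 1 / (α - 1) * Real.log
        (QDiv.traceRe (QDiv.opPow α (ρn n ω) * QDiv.opPow (1 - α) (σn n ω))) := by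
      have hmul : Measurable fun ω => QDiv.opPow α (ρn n ω) * QDiv.opPow (1 - α) (σn n ω) :=
        Continuous.measurable2 continuous_mul
          (QDiv.measurable_opPow h0 (hρn_meas n) fun ω => (hρn n ω).1)
          (QDiv.measurable_opPow h1' (hσn_meas n) fun ω => (hσn n ω).1)
      exact (Real.measurable_log.comp
        (QDiv.traceRe.continuous.measurable.comp hmul)).const_mul _
    refine ⟨_, hm, ?_⟩
    filter_upwards [hρnσn n] with ω hω
    exact QDiv.petzRenyi_toReal_of_suppLE α hω
  refine ⟨⟨QDiv.twiceDiffPow h0 hρ.1, QDiv.twiceDiffPow h1' hσ.1⟩, fun hL => ?_, ?_⟩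
  · have hpos : 0 < QDiv.overlap α ρ σ 0 := by
      rw [QDiv.overlap_zero]
      exact QDiv.trace_re_opPow_mul_opPow_pos hρ.1 hσ.1 hρσ hρ.ne_zero h0 h1'
    set c := (α - 1) * QDiv.overlap α ρ σ 0 with hc
    have hlim := QDiv.tendstoInDistribution_of_tendstoUniformlyOn hL
      (Y := fun n ω => r n * ((QDiv.petzRenyi α (ρn n ω) (σn n ω)).toReal
          - (QDiv.petzRenyi α ρ σ).toReal))
      (fun n => ((hmeas n).sub_const _).const_mul _)
      (f := fun x => QDiv.overlapDeriv α ρ σ x / c)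
      ((QDiv.overlapDeriv α ρ σ).continuous.div_const _)
      (F := fun n x => r n ^ 1 * (1 / (α - 1) * (Real.log (QDiv.overlap α ρ σ ((r n)⁻¹ • x))
        - Real.log (QDiv.overlap α ρ σ 0))))
      (QDiv.tendstoUniformlyOn_rescale (G := fun x => 1 / (α - 1) *
        (Real.log (QDiv.overlap α ρ σ x) - Real.log (QDiv.overlap α ρ σ 0)))
        (((QDiv.isLittleO_log_overlap h0 h1 hρ.1 hσ.1 hpos).const_mul_left
          (1 / (α - 1))).congr_left fun x => by rw [hc]; field_simp)
        (fun t x => by simp [mul_div_assoc]) hr_pos hr) fun n => by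
        filter_upwards [hρnσn n, hσnσ n, hρnρ n] with ω hω1 hω2 hω3
        rw [Prod.smul_mk, inv_smul_smul₀ (hr_pos n).ne', inv_smul_smul₀ (hr_pos n).ne',
          QDiv.overlap_sub hρ.1.1 hσ.1.1 (hρn n ω).1.1 (hσn n ω).1.1 hω3 hω2,
          QDiv.petzRenyi_toReal_of_suppLE α hω1, QDiv.petzRenyi_toReal_of_suppLE α hρσ,
          QDiv.overlap_zero, pow_one, mul_sub (1 / (α - 1))]
    simpa only [QDiv.overlapDeriv_apply, QDiv.hermPart_coe, QDiv.traceRe_apply, hc,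
      QDiv.overlap_zero] using hlim
  · rintro rfl hL
    -- The first-order term inside the logarithm is zero on the increments of the data; subtracting
    -- it makes the expansion start in degree two on the whole space.
    have hlim := QDiv.tendstoInDistribution_of_tendstoUniformlyOn hL
      (Y := fun n ω => r n ^ 2 * (QDiv.petzRenyi α (ρn n ω) (σn n ω)).toReal)
      (fun n => (hmeas n).const_mul _)
      (f := fun x => QDiv.overlapHess α ρ ρ x / (2 * (α - 1)))
      ((QDiv.continuous_overlapHess α ρ ρ).div_const _)
      (F := fun n x => r n ^ 2 * (1 / (α - 1) * Real.log (QDiv.overlap α ρ ρ ((r n)⁻¹ • x)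
        - QDiv.overlapDeriv α ρ ρ ((r n)⁻¹ • x))))
      (QDiv.tendstoUniformlyOn_rescale (G := fun x => 1 / (α - 1) *
        Real.log (QDiv.overlap α ρ ρ x - QDiv.overlapDeriv α ρ ρ x))
        (((QDiv.isLittleO_log_overlap_sub h0 h1 hρ.1 hρ.1
          (QDiv.overlap_zero_of_self hρ)).const_mul_left
          (1 / (α - 1))).congr_left fun x => by field_simp)
        (fun t x => by rw [QDiv.overlapHess_smul, mul_div_assoc]) hr_pos hr) fun n => by
        filter_upwards [hρnσn n, hσnσ n, hρnρ n] with ω hω1 hω2 hω3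
        rw [Prod.smul_mk, inv_smul_smul₀ (hr_pos n).ne', inv_smul_smul₀ (hr_pos n).ne',
          QDiv.overlapDeriv_self_sub h0 h1 hρ (hρn n ω) (hσn n ω) hω3 hω2, sub_zero,
          QDiv.overlap_sub hρ.1.1 hρ.1.1 (hρn n ω).1.1 (hσn n ω).1.1 hω3 hω2,
          QDiv.petzRenyi_toReal_of_suppLE α hω1]
    simpa only [QDiv.overlapHess, QDiv.hermPart_coe, QDiv.traceRe_apply] using hlim
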